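/- Consider a two-sided matching market with finite sides $I$ and $J$ and a horizon of $T$ periods. Every user $\ell\in I\cup J$ has an initial set of potentials $\mathcal P^1_\ell$ on the opposite side and a capacity $K_\ell\in\mathbb N$. In period $t$ the platform displays to each user $\ell$ a set $S^t_\ell\subseteq\mathcal P^t_\ell$ with $|S^t_\ell|\le K_\ell$. Each user $\ell$ who is shown $\ell'$ likes $\ell'$ with a known, time-independent probability $\phi_{\ell,\ell'}\in[0,1]$ and dislikes $\ell'$ otherwise; all these decisions are independent. After each period, the set of potentials of $\ell$ loses the profiles displayed to $\ell$ and the users who disliked $\ell$. The backlog $\mathcal B^t_\ell\subseteq\mathcal P^t_\ell$ consists of the users who liked $\ell$ before period $t$ and have not been displayed to $\ell$ yet. A match between $\ell$ and $\ell'$ occurs when each of them has seen and liked the other. A (possibly randomized) policy chooses the displayed sets of every period as a function of the past displays and like/dislike decisions. A policy is admissible for one-directional interactions (initiated by $I$) and sequential matches if, in every period, users in $J$ are shown only profiles from their backlog or potentials who see them in the same period, and no two users see each other in the same period. (Hence $S^t_j\subseteq\mathcal B^t_j$ for all $j\in J$.) A policy is semi-adaptive if the profiles that initiate an interaction, i.e.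 those displayed from outside the backlog, are chosen independently of the users' past decisions, whereas the profiles displayed from the backlog may depend on them. Theorem 3. For every such market and every $T$ there is an admissible semi-adaptive policy whose expected total number of matches over the $T$ periods is at least $(1-1/e)$ times that of every admissible, fully adaptive policy; that is, it is a $(1-1/e)$-approximation relative to the best adaptive policy with one-directional interactions and sequential matches. -/

import Mathlib

/-- The users of a two-sided market with sides `I` and `J`. -/
abbrev User (I J : Type*) := I ⊕ J

/-- A two-sided dating market with time-homogeneous like probabilities.
`K ℓ` is the number of profiles that `ℓ` can see per period, `pot ℓ` the initial set of potentials
of `ℓ` (contained in the opposite side), and `phi ℓ m` the probability that `ℓ` likes `m`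
when `m` is displayed to `ℓ`. -/
structure Market (I J : Type*) where
  K : User I J → ℕ
  pot : User I J → Finset (User I J)
  pot_bipartite : ∀ ℓ, ∀ m ∈ pot ℓ, ℓ.isLeft ≠ m.isLeft
  phi : User I J → User I J → ℝ
  phi_nonneg : ∀ ℓ m, 0 ≤ phi ℓ m
  phi_le_one : ∀ ℓ m, phi ℓ m ≤ 1

/-- What the platform observes in one period: the profiles `shown ℓ` displayed to each user `ℓ`,
and the subset `liked ℓ` of them that `ℓ` liked (the others were disliked). -/
structure Record (I J : Type*) where
  shown : User I J → Finset (User I J)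
  liked : User I J → Finset (User I J)

/-- The records of the past periods, the most recent one first. -/
abbrev History (I J : Type*) := List (Record I J)

/-- A deterministic policy: after a history of length `t`, it prescribes the set of profiles
displayed to each user in the next period. -/
abbrev Policy (I J : Type*) := History I J → User I J → Finset (User I J)

/-- A realization of all like/dislike decisions: `ω t ℓ m` says whether `ℓ` likes `m` in period `t`
(in case `m` is displayed to `ℓ` in that period). Periods are numbered `0, …, T - 1`. -/
abbrev SamplePath (I J : Type*) (T : ℕ) := Fin T → User I J → User I J → Bool

section

variable {I J : Type*} [Fintype I] [Fintype J] [DecidableEq I] [DecidableEq J]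

/-- The sets of potentials after a history: remove from `ℓ`'s potentials the profiles displayed to
`ℓ` and the users who disliked `ℓ`. -/
def Market.potentials (M : Market I J) : History I J → User I J → Finset (User I J)
  | [], ℓ => M.pot ℓ
  | r :: h, ℓ =>
      M.potentials h ℓ \
        (r.shown ℓ ∪ Finset.univ.filter (fun m => ℓ ∈ r.shown m ∧ ℓ ∉ r.liked m))

/-- The backlogs after a history: the users who liked `ℓ` and have not been shown to `ℓ` yet. -/
def Market.backlog (M : Market I J) : History I J → User I J → Finset (User I J)
  | [], _ => ∅
  | r :: h, ℓ =>
      (M.backlog h ℓ ∪ (M.potentials h ℓ).filter (fun m => ℓ ∈ r.shown m ∧ ℓ ∈ r.liked m)) \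
        r.shown ℓ

/-- Does `ℓ` like `m` in period `t` of the sample path? (Irrelevant for `T ≤ t`.) -/
def SamplePath.likes {T : ℕ} (ω : SamplePath I J T) (t : ℕ) (ℓ m : User I J) : Bool :=
  if h : t < T then ω ⟨t, h⟩ ℓ m else false

/-- The history of the first `t` periods when the policy `π` is run on the sample path `ω`. -/
def Policy.run (π : Policy I J) {T : ℕ} (ω : SamplePath I J T) : ℕ → History I J
  | 0 => []
  | t + 1 =>
      { shown := π (Policy.run π ω t)
        liked := fun ℓ => (π (Policy.run π ω t) ℓ).filter (fun m => ω.likes t ℓ m = true) } ::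
      Policy.run π ω t

/-- The profiles displayed to `ℓ` in period `t`. -/
def Policy.display (π : Policy I J) {T : ℕ} (ω : SamplePath I J T) (t : ℕ) (ℓ : User I J) :
    Finset (User I J) :=
  π (π.run ω t) ℓ

/-- `ℓ` sees and likes `m` in period `t`. -/
def Policy.seesAndLikes (π : Policy I J) {T : ℕ} (ω : SamplePath I J T) (t : ℕ)
    (ℓ m : User I J) : Bool :=
  decide (m ∈ π.display ω t ℓ) && ω.likes t ℓ m

/-- The indicator that a match between `ℓ` and `m` happens in period `t`: one of them sees and likes
the other, who is in the backlog (a sequential match), or both see and like each other in period `t`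
(a non-sequential match). -/
def Market.mu (M : Market I J) (π : Policy I J) {T : ℕ} (ω : SamplePath I J T) (t : ℕ)
    (ℓ m : User I J) : ℕ :=
  if (m ∈ M.backlog (π.run ω t) ℓ ∧ π.seesAndLikes ω t ℓ m = true) ∨
      (ℓ ∈ M.backlog (π.run ω t) m ∧ π.seesAndLikes ω t m ℓ = true) ∨
      (π.seesAndLikes ω t ℓ m = true ∧ π.seesAndLikes ω t m ℓ = true)
  then 1 else 0

/-- The total number of matches over the horizon. -/
def Market.matches (M : Market I J) (π : Policy I J) {T : ℕ} (ω : SamplePath I J T) : ℕ :=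
  ∑ t : Fin T, ∑ i : I, ∑ j : J, M.mu π ω t (Sum.inl i) (Sum.inr j)

/-- The probability of a sample path: all like/dislike decisions are independent, and `ℓ` likes `m`
with probability `phi ℓ m` in every period. -/
def Market.pathProb (M : Market I J) {T : ℕ} (ω : SamplePath I J T) : ℝ :=
  ∏ t, ∏ ℓ, ∏ m, if ω t ℓ m = true then M.phi ℓ m else 1 - M.phi ℓ m

/-- The expected number of matches of a deterministic policy over `T` periods. -/
def Market.expectedMatches (M : Market I J) (T : ℕ) (π : Policy I J) : ℝ :=
  ∑ ω : SamplePath I J T, M.pathProb ω * (M.matches π ω : ℝ)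

/-- The expected number of matches of a randomized policy, i.e. of a deterministic policy that is
drawn at random, independently of the users' decisions. The series converges absolutely, as its
terms are bounded by a constant times the weights of a probability distribution. -/
noncomputable def Market.value (M : Market I J) (T : ℕ) (ρ : PMF (Policy I J)) : ℝ :=
  ∑' π, (ρ π).toReal * M.expectedMatches T π

/-- At most `K ℓ` profiles are displayed to `ℓ` in every period, all of them potentials of `ℓ`. -/
def Market.Feasible (M : Market I J) (T : ℕ) (π : Policy I J) : Prop :=
  ∀ ω : SamplePath I J T, ∀ t < T, ∀ ℓ : User I J,
    π.display ω t ℓ ⊆ M.potentials (π.run ω t) ℓ ∧ (π.display ω t ℓ).card ≤ M.K ℓ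

/-- One-directional interactions initiated by `I`: users in `J` only see profiles in their backlog,
or potentials who see them in the same period. -/
def Market.OneDirectional (M : Market I J) (T : ℕ) (π : Policy I J) : Prop :=
  ∀ ω : SamplePath I J T, ∀ t < T, ∀ j : J,
    π.display ω t (Sum.inr j) ⊆
      M.backlog (π.run ω t) (Sum.inr j) ∪
        (M.potentials (π.run ω t) (Sum.inr j)).filter (fun m => Sum.inr j ∈ π.display ω t m)

/-- Sequential matches only: no two users see each other in the same period. -/
def Policy.Sequential (T : ℕ) (π : Policy I J) : Prop :=
  ∀ ω : SamplePath I J T, ∀ t < T, ∀ (i : I) (j : J),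
    ¬ (Sum.inl i ∈ π.display ω t (Sum.inr j) ∧ Sum.inr j ∈ π.display ω t (Sum.inl i))

/-- The admissible (adaptive) policies of the platform design with one-directional interactions
and sequential matches. -/
def Market.Admissible (M : Market I J) (T : ℕ) (π : Policy I J) : Prop :=
  M.Feasible T π ∧ M.OneDirectional T π ∧ π.Sequential T

/-- Semi-adaptive policies: the profiles that initiate an interaction (those displayed from outside
the backlog) do not depend on the users' past decisions; the profiles displayed from the backlog
may depend on them. -/
def Market.SemiAdaptive (M : Market I J) (T : ℕ) (π : Policy I J) : Prop :=
  ∀ ω ω' : SamplePath I J T, ∀ t < T, ∀ ℓ : User I J,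
    π.display ω t ℓ \ M.backlog (π.run ω t) ℓ = π.display ω' t ℓ \ M.backlog (π.run ω' t) ℓ

end

/-! Sequential one-directional matching reduces to queues. User `j` can only be shown users who have
already liked `j`, so what `j` collects is governed by the vector of times at which the users `i`
like `j` (`Fin.last T` meaning never). Splitting the like probabilities of `j` into layers, the best
collectable value is a nonnegative combination of numbers of customers served by queues of rate `K`.
Every admissible policy is bounded by this function (`shownCount_le`), and showing the best members
of the backlog attains it for all layers at once (`served_le_shownCount`).

The function has diminishing marginal contributions (`hasMarginalBound_served`), so replacing
correlated like times by independent ones with the same marginals costs at most a factor `1 - 1/e`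
(`HasMarginalBound.correlation_gap`).

Given an adaptive policy, let every `i` simulate it on a private sample path and use the resulting
display times as a fixed schedule. Capacities of `i` hold because all its times come from one path.
For each `j` the like times become independent with unchanged marginals, since a decision is
independent of the history leading to the display. Correlation between different `j` is harmless by
linearity. Some realization of the private paths is at least as good as the average
(`exists_schedule`), and there are finitely many schedules, so the best one competes with all
policies. -/

/-! ### Product laws and the correlation gap. -/

section ProductWeights

variable {ι α : Type*} [Fintype ι] [DecidableEq ι] [Fintype α]

/-- The product rule deletes one factor of a product weight; this rewrites the result as an
expectation under the full weight. -/
theorem sum_prod_erase_mul (W : ι → α → ℝ) (i : ι) (hW : ∑ a, W i a = 1) (g : α → ℝ)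
    (F : (ι → α) → ℝ) :
    ∑ Z : ι → α, (∏ k ∈ Finset.univ.erase i, W k (Z k)) * g (Z i) * F Z =
      ∑ Z : ι → α, (∏ k, W k (Z k)) * ∑ a, g a * F (Function.update Z i a) := by
  have hprod : ∀ Z : ι → α, ∀ a, ∏ k ∈ Finset.univ.erase i, W k (Function.update Z i a k) =
      ∏ k ∈ Finset.univ.erase i, W k (Z k) := fun Z a =>
    Finset.prod_congr rfl fun k hk => by
      rw [Function.update_of_ne (Finset.ne_of_mem_erase hk)]
  have hfull : ∀ Z : ι → α, ∏ k, W k (Z k) =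
      W i (Z i) * ∏ k ∈ Finset.univ.erase i, W k (Z k) := fun Z =>
    (Finset.mul_prod_erase _ _ (Finset.mem_univ i)).symm
  -- Adjoin an independent `a` with law `W i` and exchange it with the coordinate `Z i`; the
  -- exchange is an involution.
  let e : (ι → α) × α ≃ (ι → α) × α :=
    { toFun := fun p => (Function.update p.1 i p.2, p.1 i)
      invFun := fun p => (Function.update p.1 i p.2, p.1 i)
      left_inv := fun p => by simp
      right_inv := fun p => by simp }
  calc ∑ Z : ι → α, (∏ k ∈ Finset.univ.erase i, W k (Z k)) * g (Z i) * F Z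
      = ∑ Z : ι → α, ∑ a,
          W i a * ((∏ k ∈ Finset.univ.erase i, W k (Z k)) * g (Z i) * F Z) := by
        refine Finset.sum_congr rfl fun Z _ => ?_
        rw [← Finset.sum_mul, hW, one_mul]
    _ = ∑ p : (ι → α) × α,
          W i p.2 * ((∏ k ∈ Finset.univ.erase i, W k (p.1 k)) * g (p.1 i) * F p.1) := by
        rw [Fintype.sum_prod_type]
    _ = ∑ p : (ι → α) × α, W i (p.1 i) * ((∏ k ∈ Finset.univ.erase i, W k (p.1 k)) * g p.2 *
          F (Function.update p.1 i p.2)) := by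
        refine (Fintype.sum_equiv e _ _ fun p => ?_).symm
        simp [e, hprod]
    _ = _ := by
        rw [Fintype.sum_prod_type]
        refine Finset.sum_congr rfl fun Z _ => ?_
        rw [Finset.mul_sum]
        refine Finset.sum_congr rfl fun a _ => ?_
        rw [hfull]
        ring

theorem sum_prod_mul_resample (W : ι → α → ℝ) (i : ι) (hW : ∑ a, W i a = 1)
    (F : (ι → α) → ℝ) :
    ∑ Z : ι → α, (∏ k, W k (Z k)) * F Z =
      ∑ Z : ι → α, (∏ k, W k (Z k)) * ∑ a, W i a * F (Function.update Z i a) := by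
  rw [← sum_prod_erase_mul W i hW (W i) F]
  refine Finset.sum_congr rfl fun Z _ => ?_
  rw [← Finset.prod_erase_mul _ (fun k => W k (Z k)) (Finset.mem_univ i)]

theorem sum_prod_eq_one (W : ι → α → ℝ) (hW : ∀ i, ∑ a, W i a = 1) :
    ∑ Z : ι → α, ∏ k, W k (Z k) = 1 := by
  have h := Finset.prod_univ_sum (fun _ : ι => (Finset.univ : Finset α)) W
  simp only [Fintype.piFinset_univ] at h
  rw [← h]
  simp [hW]

/-- The property of a function of a finite vector that yields the correlation gap: around every
`Z`, it is bounded by a separable function whose increments are dominated by the marginal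
contributions of single coordinates (relative to the default value `o`). -/
def HasMarginalBound (o : α) (f : (ι → α) → ℝ) : Prop :=
  ∀ Z : ι → α, ∃ m : ι → α → ℝ, (∀ Y, f Y ≤ f Z + ∑ i, m i (Y i)) ∧
    ∀ i a, m i a ≤ f (Function.update Z i a) - f (Function.update Z i o)

omit [Fintype α] in
theorem HasMarginalBound.sum {o : α} {κ : Type*} (s : Finset κ) (c : κ → ℝ)
    (f : κ → (ι → α) → ℝ) (hc : ∀ k ∈ s, 0 ≤ c k) (hf : ∀ k ∈ s, HasMarginalBound o (f k)) :
    HasMarginalBound o (fun Y => ∑ k ∈ s, c k * f k Y) := by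
  classical
  intro Z
  choose! m hm using fun k (hk : k ∈ s) => hf k hk Z
  refine ⟨fun i a => ∑ k ∈ s, c k * m k i a, fun Y => ?_, fun i a => ?_⟩
  · rw [Finset.sum_comm, ← Finset.sum_add_distrib]
    refine Finset.sum_le_sum fun k hk => ?_
    rw [← Finset.mul_sum, ← mul_add]
    exact mul_le_mul_of_nonneg_left ((hm k hk).1 Y) (hc k hk)
  · rw [← Finset.sum_sub_distrib]
    refine Finset.sum_le_sum fun k hk => ?_
    rw [← mul_sub]
    exact mul_le_mul_of_nonneg_left ((hm k hk).2 i a) (hc k hk)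

/-- A function on the unit interval with `V - Φ ≤ Φ'` starting from a nonnegative value reaches
`(1 - 1/e) V`. -/
theorem one_sub_inv_exp_mul_le {Φ Φ' : ℝ → ℝ} {V : ℝ} (hΦ : ∀ t, HasDerivAt Φ (Φ' t) t)
    (h0 : 0 ≤ Φ 0) (h : ∀ t ∈ Set.Icc (0 : ℝ) 1, V - Φ t ≤ Φ' t) :
    (1 - 1 / Real.exp 1) * V ≤ Φ 1 := by
  have hd : ∀ t, HasDerivAt (fun t => Real.exp t * (Φ t - V))
      (Real.exp t * (Φ t - V) + Real.exp t * Φ' t) t := fun t =>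
    (Real.hasDerivAt_exp t).mul ((hΦ t).sub_const V)
  -- `Real.exp t` is the integrating factor of `Φ' + Φ ≥ V`.
  have hmono : MonotoneOn (fun t => Real.exp t * (Φ t - V)) (Set.Icc (0 : ℝ) 1) := by
    refine monotoneOn_of_deriv_nonneg (convex_Icc 0 1)
      (fun t _ => (hd t).continuousAt.continuousWithinAt)
      (fun t _ => (hd t).differentiableAt.differentiableWithinAt) fun t ht => ?_
    rw [(hd t).deriv, ← mul_add]
    have := h t (interior_subset ht)
    exact mul_nonneg (Real.exp_pos t).le (by linarith)
  have h01 := hmono (Set.left_mem_Icc.2 zero_le_one) (Set.right_mem_Icc.2 zero_le_one) zero_le_one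
  simp only [Real.exp_zero, one_mul] at h01
  have he := Real.exp_pos 1
  have h2 : -V ≤ Real.exp 1 * (Φ 1 - V) := by linarith
  have h3 : (1 - 1 / Real.exp 1) * V = V + (-V) / Real.exp 1 := by ring
  have h4 : (-V) / Real.exp 1 ≤ Φ 1 - V := by
    rw [div_le_iff₀ he]
    linarith
  linarith

/-- Correlation gap: the expectation under the independent law is at least `1 - 1/e` times the
expectation under any law with the same marginals. -/
theorem HasMarginalBound.correlation_gap [DecidableEq α] {Ω : Type*} [Fintype Ω] {o : α}
    {f : (ι → α) → ℝ} (hf : HasMarginalBound o f) (hf0 : ∀ Y, 0 ≤ f Y) (p : Ω → ℝ)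
    (hp : ∀ ω, 0 ≤ p ω) (hp1 : ∑ ω, p ω = 1) (Y : Ω → ι → α) :
    (1 - 1 / Real.exp 1) * ∑ ω, p ω * f (Y ω) ≤
      ∑ Z : ι → α, (∏ i, ∑ ω, p ω * if Y ω i = Z i then 1 else 0) * f Z := by
  set q : ι → α → ℝ := fun i a => ∑ ω, p ω * if Y ω i = a then 1 else 0 with hq
  have hqsum : ∀ i (g : α → ℝ), ∑ a, q i a * g a = ∑ ω, p ω * g (Y ω i) := by
    intro i g
    simp only [hq, Finset.sum_mul]
    rw [Finset.sum_comm]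
    refine Finset.sum_congr rfl fun ω _ => ?_
    simp
  have hq0 : ∀ i a, 0 ≤ q i a := fun i a =>
    Finset.sum_nonneg fun ω _ => mul_nonneg (hp ω) (by split_ifs <;> norm_num)
  have hq1 : ∀ i, ∑ a, q i a = 1 := fun i => by
    have := hqsum i fun _ => 1
    simpa [hp1] using this
  set d : α → ℝ := fun a => if a = o then 1 else 0 with hdd
  have hd0 : ∀ a, 0 ≤ d a := fun a => by simp only [hdd]; split_ifs <;> norm_num
  have hd1 : ∑ a, d a = 1 := by simp [hdd]
  -- Each coordinate independently follows its marginal `q i` with probability `t` and is `o`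
  -- otherwise; `t = 1` is the independent law.
  set W : ℝ → ι → α → ℝ := fun t i a => d a + t * (q i a - d a) with hWdef
  have hW1 : ∀ t i, ∑ a, W t i a = 1 := fun t i => by
    simp only [hWdef]
    rw [Finset.sum_add_distrib, ← Finset.mul_sum, Finset.sum_sub_distrib, hq1, hd1]
    ring
  have hW0 : ∀ t ∈ Set.Icc (0 : ℝ) 1, ∀ i a, 0 ≤ W t i a := fun t ht i a => by
    have : W t i a = (1 - t) * d a + t * q i a := by simp only [hWdef]; ring
    rw [this]
    exact add_nonneg (mul_nonneg (by linarith [ht.2]) (hd0 a)) (mul_nonneg ht.1 (hq0 i a))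
  set Φ : ℝ → ℝ := fun t => ∑ Z : ι → α, (∏ i, W t i (Z i)) * f Z with hΦ
  set Φ' : ℝ → ℝ := fun t => ∑ Z : ι → α, (∏ k, W t k (Z k)) *
    ∑ i, ∑ a, (q i a - d a) * f (Function.update Z i a) with hΦ'
  have hderiv : ∀ t, HasDerivAt Φ (Φ' t) t := by
    intro t
    have h1 : HasDerivAt Φ (∑ Z : ι → α,
        (∑ i, (∏ k ∈ Finset.univ.erase i, W t k (Z k)) * (q i (Z i) - d (Z i))) * f Z) t := by
      refine HasDerivAt.fun_sum fun Z _ => HasDerivAt.mul_const ?_ _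
      have := HasDerivAt.fun_finsetProd (u := Finset.univ) (f := fun i t => W t i (Z i))
        (f' := fun i => q i (Z i) - d (Z i)) (x := t) fun i _ => by
          simpa [hWdef] using
            ((hasDerivAt_id t).mul_const (q i (Z i) - d (Z i))).const_add (d (Z i))
      simpa using this
    convert h1 using 1
    simp only [hΦ', Finset.mul_sum, Finset.sum_mul]
    rw [Finset.sum_comm, Finset.sum_comm (s := (Finset.univ : Finset (ι → α)))]
    refine Finset.sum_congr rfl fun i _ => ?_
    rw [sum_prod_erase_mul (W t) i (hW1 t i) (fun a => q i a - d a) f]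
    simp only [Finset.mul_sum]
  have hmain := one_sub_inv_exp_mul_le (V := ∑ ω, p ω * f (Y ω)) hderiv
    (by
      have : ∀ Z : ι → α, 0 ≤ ∏ i, W 0 i (Z i) := fun Z =>
        Finset.prod_nonneg fun i _ => hW0 0 ⟨le_rfl, zero_le_one⟩ i _
      exact Finset.sum_nonneg fun Z _ => mul_nonneg (this Z) (hf0 Z))
    -- The differential inequality is `HasMarginalBound` averaged over `Z` from the product law at
    -- `t` and, independently, `Y ω` from the correlated law.
    (by
      intro t ht
      have hsum : ∑ Z : ι → α, ∏ i, W t i (Z i) = 1 := sum_prod_eq_one _ (hW1 t)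
      have : ∑ ω, p ω * f (Y ω) =
          ∑ Z : ι → α, (∏ i, W t i (Z i)) * ∑ ω, p ω * f (Y ω) := by
        rw [← Finset.sum_mul, hsum, one_mul]
      rw [this, hΦ, hΦ', ← Finset.sum_sub_distrib]
      refine Finset.sum_le_sum fun Z _ => ?_
      rw [← mul_sub]
      refine mul_le_mul_of_nonneg_left ?_ (Finset.prod_nonneg fun i _ => hW0 t ht i _)
      obtain ⟨m, hm1, hm2⟩ := hf Z
      have e1 : ∀ i, ∑ a, (q i a - d a) * f (Function.update Z i a) =
          ∑ ω, p ω * (f (Function.update Z i (Y ω i)) - f (Function.update Z i o)) := by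
        intro i
        simp only [sub_mul, mul_sub, Finset.sum_sub_distrib]
        rw [hqsum i fun a => f (Function.update Z i a), ← Finset.sum_mul, hp1]
        simp [hdd]
      calc ∑ ω, p ω * f (Y ω) - f Z = ∑ ω, p ω * (f (Y ω) - f Z) := by
            simp only [mul_sub, Finset.sum_sub_distrib]
            rw [← Finset.sum_mul, hp1, one_mul]
        _ ≤ ∑ ω, p ω * ∑ i, (f (Function.update Z i (Y ω i)) - f (Function.update Z i o)) := by
            refine Finset.sum_le_sum fun ω _ => mul_le_mul_of_nonneg_left ?_ (hp ω)
            have := hm1 (Y ω)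
            have h2 := Finset.sum_le_sum fun i (_ : i ∈ Finset.univ) => hm2 i (Y ω i)
            linarith
        _ = _ := by
            simp only [e1, Finset.mul_sum]
            rw [Finset.sum_comm])
  refine hmain.trans_eq ?_
  simp only [hΦ, hWdef, one_mul, add_sub_cancel]
  rfl

end ProductWeights

/-! ### A queue serving at rate `K`, as a function of the arrival times. -/

section Queue

variable {ι : Type*} [Fintype ι] [DecidableEq ι] {T : ℕ}

/-- The number of members of `U` arriving before time `t`. -/
def arrivals (U : Finset ι) (Y : ι → Fin (T + 1)) (t : ℕ) : ℕ :=
  (U.filter fun i => (Y i : ℕ) < t).card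

/-- The number of members of `U` served before time `t` by a queue that serves `K` waiting
customers per period. -/
def served (U : Finset ι) (K : ℕ) (Y : ι → Fin (T + 1)) : ℕ → ℕ
  | 0 => 0
  | t + 1 => min (served U K Y t + K) (arrivals U Y t)

omit [Fintype ι] in
theorem arrivals_update (U : Finset ι) (Y : ι → Fin (T + 1)) (t : ℕ) {i : ι} (hi : i ∈ U)
    (a : Fin (T + 1)) :
    arrivals U (Function.update Y i a) t =
      ((U.erase i).filter fun k => (Y k : ℕ) < t).card + if (a : ℕ) < t then 1 else 0 := by
  unfold arrivals
  conv_lhs => rw [← Finset.insert_erase hi]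
  have h : (U.erase i).filter (fun k => (Function.update Y i a k : ℕ) < t) =
      (U.erase i).filter (fun k => (Y k : ℕ) < t) :=
    Finset.filter_congr fun k hk => by
      rw [Function.update_of_ne (Finset.ne_of_mem_erase hk)]
  rw [Finset.filter_insert, h]
  simp only [Function.update_self]
  split_ifs
  · rw [Finset.card_insert_of_notMem (by simp)]
  · simp

omit [Fintype ι] in
theorem arrivals_update_top (U : Finset ι) (Y : ι → Fin (T + 1)) {t : ℕ} (ht : t ≤ T) {i : ι}
    (hi : i ∈ U) {a : Fin (T + 1)} :
    arrivals U (Function.update Y i a) t =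
      arrivals U (Function.update Y i (Fin.last T)) t + if (a : ℕ) < t then 1 else 0 := by
  rw [arrivals_update U Y t hi, arrivals_update U Y t hi]
  simp [not_lt.2 ht]

omit [Fintype ι] in
theorem served_update_top_le (U : Finset ι) (K : ℕ) (Y : ι → Fin (T + 1)) {t : ℕ} (ht : t ≤ T)
    {i : ι} (hi : i ∈ U) (a : Fin (T + 1)) :
    served U K (Function.update Y i (Fin.last T)) t ≤ served U K (Function.update Y i a) t := by
  induction t with
  | zero => simp [served]
  | succ t ih =>
    have := ih (by omega)
    have h2 := arrivals_update_top U Y (a := a) (t := t) (by omega) hi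
    simp only [served]
    omega

omit [Fintype ι] in
theorem served_update_le (U : Finset ι) (K : ℕ) (Y : ι → Fin (T + 1)) {t : ℕ} (ht : t ≤ T)
    {i : ι} (hi : i ∈ U) (a : Fin (T + 1)) :
    served U K (Function.update Y i a) t ≤
      served U K (Function.update Y i (Fin.last T)) t + if (a : ℕ) < t then 1 else 0 := by
  induction t with
  | zero => simp [served]
  | succ t ih =>
    have := ih (by omega)
    have h2 := arrivals_update_top U Y (a := a) (t := t) (by omega) hi
    simp only [served]
    split_ifs at * <;> omega

omit [Fintype ι] in
-- Unrolling the recursion, `served` at `t` is the minimum of `K * t` and the terms `arrivals s + K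
-- * (t - 1 - s)` for `s < t`. The threshold is the first bottleneck of `Z`. For any `Y` the same
-- term is an upper bound, whence the first property. Terms before the bottleneck have slack, and an
-- arrival before it raises all the later ones, whence the second.
theorem exists_served_threshold (U : Finset ι) (K : ℕ) (Z : ι → Fin (T + 1)) {t : ℕ}
    (ht : t ≤ T) :
    ∃ s ≤ t, (∀ Y : ι → Fin (T + 1), served U K Y t + arrivals U Z s ≤ served U K Z t + arrivals U Y s) ∧
      ∀ i ∈ U, ∀ a : Fin (T + 1), (a : ℕ) < s →
        served U K (Function.update Z i (Fin.last T)) t + 1 ≤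
          served U K (Function.update Z i a) t := by
  induction t with
  | zero => exact ⟨0, le_rfl, by simp [served, arrivals], by simp⟩
  | succ t ih =>
    obtain ⟨s, hst, h1, h2⟩ := ih (by omega)
    -- The inequality is strict so that a tie keeps the earlier bottleneck: the terms before it must
    -- be strictly larger.
    by_cases hc : arrivals U Z t < served U K Z t + K
    · refine ⟨t, by omega, fun Y => ?_, fun i hi a ha => ?_⟩
      · simp only [served]
        omega
      · have e1 := arrivals_update_top U Z (a := a) (t := t) (by omega) hi
        have e2 := arrivals_update_top U Z (a := Z i) (t := t) (by omega) hi
        have e3 := served_update_le U K Z (t := t) (by omega) hi (Z i)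
        have e4 := served_update_top_le U K Z (t := t) (by omega) hi a
        rw [Function.update_eq_self] at e2 e3
        simp only [served]
        split_ifs at * <;> omega
    · refine ⟨s, by omega, fun Y => ?_, fun i hi a ha => ?_⟩
      · have := h1 Y
        simp only [served]
        omega
      · have e1 := arrivals_update_top U Z (a := a) (t := t) (by omega) hi
        have e2 := h2 i hi a ha
        rw [if_pos (by omega)] at e1
        simp only [served]
        omega

theorem hasMarginalBound_served (U : Finset ι) (K : ℕ) :
    HasMarginalBound (Fin.last T) fun Y : ι → Fin (T + 1) => (served U K Y T : ℝ) := by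
  intro Z
  obtain ⟨s, hs, h1, h2⟩ := exists_served_threshold U K Z le_rfl
  -- Only arrivals before the bottleneck `s` count. Since `s ≤ T`, the default `Fin.last T` counts
  -- zero.
  refine ⟨fun i a => if i ∈ U ∧ (a : ℕ) < s then 1 else 0, fun Y => ?_, fun i a => ?_⟩
  · have h3 : ∑ i, (if i ∈ U ∧ (Y i : ℕ) < s then (1 : ℝ) else 0) = (arrivals U Y s : ℝ) := by
      rw [Finset.sum_boole, arrivals]
      congr 2
      ext i
      simp
    rw [h3]
    have := h1 Y
    simp only
    exact_mod_cast (by omega : served U K Y T ≤ served U K Z T + arrivals U Y s)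
  · simp only
    split_ifs with h
    · have := h2 i h.1 a h.2
      rw [le_sub_iff_add_le, add_comm]
      exact_mod_cast this
    · rw [sub_nonneg]
      by_cases hi : i ∈ U
      · exact_mod_cast served_update_top_le U K Z le_rfl hi a
      · have : ∀ (b : Fin (T + 1)) (t : ℕ), served U K (Function.update Z i b) t =
            served U K Z t := by
          intro b t
          induction t with
          | zero => rfl
          | succ t ih =>
            simp only [served, ih, arrivals]
            congr 2
            exact Finset.filter_congr fun k hk => by
              rw [Function.update_of_ne (ne_of_mem_of_not_mem hk hi)]
        rw [this, this]

end Queue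

/-! ### Top subsets and layers of weights. -/

/-- Every finite set contains a subset of at most `K` members with the largest weights. -/
theorem exists_top_subset {β : Type*} [DecidableEq β] (w : β → ℝ) (K : ℕ) (B : Finset β) :
    ∃ S ⊆ B, S.card ≤ K ∧
      ∀ θ, min K (B.filter fun x => θ ≤ w x).card ≤ (S.filter fun x => θ ≤ w x).card := by
  induction K generalizing B with
  | zero => exact ⟨∅, by simp⟩
  | succ K ih =>
    rcases B.eq_empty_or_nonempty with rfl | hB
    · exact ⟨∅, by simp⟩
    obtain ⟨m, hm, hmax⟩ := B.exists_max_image w hB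
    obtain ⟨S, hSB, hcard, hS⟩ := ih (B.erase m)
    have hmS : m ∉ S := fun h => by simpa using hSB h
    refine ⟨insert m S, ?_, ?_, fun θ => ?_⟩
    · exact Finset.insert_subset hm (hSB.trans (Finset.erase_subset _ _))
    · rw [Finset.card_insert_of_notMem hmS]
      omega
    · by_cases hθ : θ ≤ w m
      · have h1 := hS θ
        have h2 : (B.filter fun x => θ ≤ w x).card =
            ((B.erase m).filter fun x => θ ≤ w x).card + 1 := by
          conv_lhs => rw [← Finset.insert_erase hm]
          rw [Finset.filter_insert, if_pos hθ, Finset.card_insert_of_notMem (by simp)]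
        rw [Finset.filter_insert, if_pos hθ, Finset.card_insert_of_notMem (by simp [hmS])]
        omega
      · have : (B.filter fun x => θ ≤ w x) = ∅ :=
          Finset.filter_eq_empty_iff.2 fun x hx h => hθ (h.trans (hmax x hx))
        simp [this]

/-- Layer-cake decomposition of finitely many nonnegative reals. -/
theorem exists_layer_weights (W : Finset ℝ) (hW : ∀ v ∈ W, 0 ≤ v) :
    ∃ c : ℝ → ℝ, (∀ θ ∈ W, 0 ≤ c θ) ∧ ∀ v ∈ W, v = ∑ θ ∈ W, c θ * if θ ≤ v then 1 else 0 := by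
  induction W using Finset.induction_on_max with
  | empty => exact ⟨fun _ => 0, by simp⟩
  | insert a s hs ih =>
    obtain ⟨c, hc, hv⟩ := ih fun v hv => hW v (Finset.mem_insert_of_mem hv)
    have ha : a ∉ s := fun h => lt_irrefl _ (hs a h)
    have hsum : ∑ θ ∈ s, c θ ≤ a := by
      rcases s.eq_empty_or_nonempty with rfl | hne
      · simpa using hW a
      · have hmem := s.max'_mem hne
        have h1 := hv _ hmem
        have h2 : ∑ θ ∈ s, c θ * (if θ ≤ s.max' hne then 1 else 0) = ∑ θ ∈ s, c θ :=
          Finset.sum_congr rfl fun θ hθ => by rw [if_pos (s.le_max' θ hθ), mul_one]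
        rw [← h2, ← h1]
        exact (hs _ hmem).le
    -- The earlier weights sum to the largest value so far, so the new top layer has the gap up to
    -- `a` as its weight.
    refine ⟨fun θ => if θ = a then a - ∑ θ ∈ s, c θ else c θ, fun θ hθ => ?_, fun v hv' => ?_⟩
    · simp only
      split_ifs with h
      · linarith
      · exact hc θ ((Finset.mem_insert.1 hθ).resolve_left h)
    · rw [Finset.sum_insert ha]
      have h3 : ∀ v : ℝ, ∑ θ ∈ s, (if θ = a then a - ∑ θ ∈ s, c θ else c θ) *
          (if θ ≤ v then (1 : ℝ) else 0) = ∑ θ ∈ s, c θ * if θ ≤ v then 1 else 0 := fun v =>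
        Finset.sum_congr rfl fun θ hθ => by rw [if_neg fun h : θ = a => ha (h ▸ hθ)]
      rw [h3]
      rcases Finset.mem_insert.1 hv' with rfl | hvs
      · have h4 : ∑ θ ∈ s, c θ * (if θ ≤ v then 1 else 0) = ∑ θ ∈ s, c θ :=
          Finset.sum_congr rfl fun θ hθ => by rw [if_pos (hs θ hθ).le, mul_one]
        rw [h4]
        simp
      · rw [← hv v hvs]
        simp [not_le.2 (hs v hvs)]

set_option linter.unusedSectionVars false

/-! ### Expectations over independent decisions, and runs of policies. -/

section Market

variable {I J : Type*} [Fintype I] [Fintype J] [DecidableEq I] [DecidableEq J] {T : ℕ}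

/-- The expectation of a function of the like/dislike decisions. -/
def Market.expect (M : Market I J) (G : SamplePath I J T → ℝ) : ℝ :=
  ∑ ω, M.pathProb ω * G ω

/-- Prescribe the decision of `ℓ` about `m` in period `t`. -/
def SamplePath.set (ω : SamplePath I J T) (t : Fin T) (ℓ m : User I J) (b : Bool) :
    SamplePath I J T :=
  fun s k n => if (s, k, n) = (t, ℓ, m) then b else ω s k n

theorem SamplePath.set_self (ω : SamplePath I J T) (t : Fin T) (ℓ m : User I J) (b : Bool) :
    ω.set t ℓ m b t ℓ m = b := by
  simp [SamplePath.set]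

theorem Market.pathProb_nonneg (M : Market I J) (ω : SamplePath I J T) : 0 ≤ M.pathProb ω :=
  Finset.prod_nonneg fun _ _ => Finset.prod_nonneg fun ℓ _ => Finset.prod_nonneg fun m _ => by
    split_ifs
    · exact M.phi_nonneg ℓ m
    · linarith [M.phi_le_one ℓ m]

/-- A sample path as a function on the triples of a period and two users. -/
def SamplePath.uncurryEquiv :
    SamplePath I J T ≃ (Fin T × User I J × User I J → Bool) where
  toFun ω k := ω k.1 k.2.1 k.2.2
  invFun Z t ℓ m := Z (t, ℓ, m)
  left_inv _ := rfl
  right_inv _ := rfl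

/-- The law of the decision indexed by a triple. -/
def Market.coin (M : Market I J) (T : ℕ) (k : Fin T × User I J × User I J) (b : Bool) : ℝ :=
  if b = true then M.phi k.2.1 k.2.2 else 1 - M.phi k.2.1 k.2.2

theorem Market.sum_coin (M : Market I J) (k : Fin T × User I J × User I J) :
    ∑ b, M.coin T k b = 1 := by
  simp [Market.coin]

theorem Market.pathProb_eq_prod (M : Market I J) (ω : SamplePath I J T) :
    M.pathProb ω = ∏ k, M.coin T k (SamplePath.uncurryEquiv ω k) := by
  simp only [Fintype.prod_prod_type]
  rfl

theorem Market.expect_eq_sum (M : Market I J) (G : SamplePath I J T → ℝ) :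
    M.expect G = ∑ Z : Fin T × User I J × User I J → Bool,
      (∏ k, M.coin T k (Z k)) * G (SamplePath.uncurryEquiv.symm Z) :=
  Fintype.sum_equiv SamplePath.uncurryEquiv _ _ fun ω => by
    rw [M.pathProb_eq_prod, Equiv.symm_apply_apply]

theorem Market.sum_pathProb (M : Market I J) : ∑ ω : SamplePath I J T, M.pathProb ω = 1 := by
  have h := M.expect_eq_sum (T := T) fun _ => 1
  simp only [Market.expect, mul_one] at h
  rw [h, sum_prod_eq_one _ M.sum_coin]

theorem Market.expect_resample (M : Market I J) (t : Fin T) (ℓ m : User I J)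
    (G : SamplePath I J T → ℝ) :
    M.expect G = M.expect fun ω =>
      M.phi ℓ m * G (ω.set t ℓ m true) + (1 - M.phi ℓ m) * G (ω.set t ℓ m false) := by
  rw [M.expect_eq_sum, M.expect_eq_sum, sum_prod_mul_resample _ (t, ℓ, m) (M.sum_coin _)]
  refine Finset.sum_congr rfl fun Z _ => ?_
  have h : ∀ b, SamplePath.uncurryEquiv.symm (Function.update Z (t, ℓ, m) b) =
      (SamplePath.uncurryEquiv.symm Z).set t ℓ m b := by
    intro b
    funext s k n
    simp [SamplePath.uncurryEquiv, SamplePath.set, Function.update_apply]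
  simp [h, Market.coin]

theorem Market.expect_const_mul (M : Market I J) (c : ℝ) (G : SamplePath I J T → ℝ) :
    (M.expect fun ω => c * G ω) = c * M.expect G := by
  simp only [Market.expect, Finset.mul_sum]
  exact Finset.sum_congr rfl fun ω _ => by ring

theorem Market.expect_sum (M : Market I J) {κ : Type*} (s : Finset κ)
    (G : κ → SamplePath I J T → ℝ) :
    (M.expect fun ω => ∑ k ∈ s, G k ω) = ∑ k ∈ s, M.expect (G k) := by
  simp only [Market.expect, Finset.mul_sum]
  exact Finset.sum_comm

theorem Market.expect_mono (M : Market I J) {G H : SamplePath I J T → ℝ} (h : ∀ ω, G ω ≤ H ω) :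
    M.expect G ≤ M.expect H :=
  Finset.sum_le_sum fun ω _ => mul_le_mul_of_nonneg_left (h ω) (M.pathProb_nonneg ω)

/-- Independence of one decision from everything not affected by it; used with `g` determined by the
past of period `t`. -/
theorem Market.expect_mul_decision (M : Market I J) (t : Fin T) (ℓ m : User I J)
    (g : SamplePath I J T → ℝ) (hg : ∀ ω b, g (ω.set t ℓ m b) = g ω) (h : Bool → ℝ) :
    (M.expect fun ω => g ω * h (ω t ℓ m)) =
      (M.phi ℓ m * h true + (1 - M.phi ℓ m) * h false) * M.expect g := by
  rw [M.expect_resample t ℓ m, ← M.expect_const_mul]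
  congr 1
  funext ω
  simp only [hg, SamplePath.set_self]
  ring

theorem SamplePath.likes_of_fin (ω : SamplePath I J T) (t : Fin T) (ℓ m : User I J) :
    ω.likes t ℓ m = ω t ℓ m := by
  simp [SamplePath.likes]

theorem SamplePath.likes_set_of_ne (ω : SamplePath I J T) (t : Fin T) (ℓ m : User I J) (b : Bool)
    {s : ℕ} {k n : User I J} (h : (s, k, n) ≠ ((t : ℕ), ℓ, m)) :
    (ω.set t ℓ m b).likes s k n = ω.likes s k n := by
  unfold SamplePath.likes SamplePath.set
  split_ifs with h1 h2
  · exact absurd (by simpa [Fin.ext_iff] using h2) h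
  · rfl
  · rfl

theorem Policy.run_congr (π : Policy I J) {ω ω' : SamplePath I J T} {t : ℕ}
    (h : ∀ s < t, ω.likes s = ω'.likes s) : π.run ω t = π.run ω' t := by
  induction t with
  | zero => rfl
  | succ t ih =>
    simp only [Policy.run]
    rw [ih fun s hs => h s (by omega), h t (by omega)]

theorem Policy.length_run (π : Policy I J) (ω : SamplePath I J T) (t : ℕ) :
    (π.run ω t).length = t := by
  induction t with
  | zero => rfl
  | succ t ih => simp [Policy.run, ih]

/-- Policies do not anticipate: the display of period `t` itself uses only decisions made before
`t`, so `s = t` is allowed. -/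
theorem Policy.display_set (π : Policy I J) (ω : SamplePath I J T) (t : Fin T) (ℓ m : User I J)
    (b : Bool) {s : ℕ} (hs : s ≤ t) : π.display (ω.set t ℓ m b) s = π.display ω s := by
  unfold Policy.display
  rw [π.run_congr (ω' := ω) fun u hu => ?_]
  funext k n
  exact ω.likes_set_of_ne t ℓ m b fun h => by
    have := (Prod.ext_iff.1 h).1
    simp only at this
    omega

/-- The time at which `ℓ` likes a profile `m` displayed at time `b`, or `T` if this never
happens. -/
def SamplePath.likeTime (ω : SamplePath I J T) (b : Fin (T + 1)) (ℓ m : User I J) : Fin (T + 1) :=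
  if ω.likes b ℓ m = true then b else Fin.last T

/-- The law of `SamplePath.likeTime` for a fixed display time `b` and like probability `x`. -/
def likeTimeLaw (x : ℝ) (b a : Fin (T + 1)) : ℝ :=
  x * (if a = b then 1 else 0) + (1 - x) * (if a = Fin.last T then 1 else 0)

theorem SamplePath.likeTime_last (ω : SamplePath I J T) (ℓ m : User I J) :
    ω.likeTime (Fin.last T) ℓ m = Fin.last T := by
  simp [SamplePath.likeTime]

theorem Market.expect_mul_likeTime (M : Market I J) (b : Fin (T + 1)) (ℓ m : User I J)
    (g : SamplePath I J T → ℝ)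
    (hg : ∀ t : Fin T, t.castSucc = b → ∀ ω x, g (ω.set t ℓ m x) = g ω) (a : Fin (T + 1)) :
    (M.expect fun ω => g ω * if ω.likeTime b ℓ m = a then 1 else 0) =
      likeTimeLaw (M.phi ℓ m) b a * M.expect g := by
  induction b using Fin.lastCases with
  | last =>
    simp only [SamplePath.likeTime_last, likeTimeLaw]
    rw [← M.expect_const_mul]
    congr 1
    funext ω
    simp only [eq_comm (a := a)]
    ring
  | cast t =>
    have h := M.expect_mul_decision t ℓ m g (hg t rfl)
      fun x => if (if x = true then t.castSucc else Fin.last T) = a then 1 else 0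
    simp only [SamplePath.likeTime, Fin.val_castSucc, SamplePath.likes_of_fin]
    rw [h]
    simp [likeTimeLaw, eq_comm (a := a)]

/-- With display times fixed in advance, distinct users `i` decide about `j` by distinct coins, so
their like times are independent. -/
theorem Market.expect_likeTime (M : Market I J) (b : I → Fin (T + 1)) (j : J)
    (F : (I → Fin (T + 1)) → ℝ) :
    (M.expect fun ω => F fun i => ω.likeTime (b i) (Sum.inl i) (Sum.inr j)) =
      ∑ Z : I → Fin (T + 1),
        (∏ i, likeTimeLaw (M.phi (Sum.inl i) (Sum.inr j)) (b i) (Z i)) * F Z := by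
  have hprod : ∀ (Z : I → Fin (T + 1)) (s : Finset I),
      (M.expect fun ω => ∏ i ∈ s,
        if ω.likeTime (b i) (Sum.inl i) (Sum.inr j) = Z i then (1 : ℝ) else 0) =
      ∏ i ∈ s, likeTimeLaw (M.phi (Sum.inl i) (Sum.inr j)) (b i) (Z i) := by
    intro Z s
    induction s using Finset.induction_on with
    | empty => simp [Market.expect, M.sum_pathProb]
    | insert i s hi ih =>
      simp only [Finset.prod_insert hi]
      rw [← ih, ← M.expect_mul_likeTime]
      · simp only [mul_comm]
      · intro t _ ω x
        refine Finset.prod_congr rfl fun k hk => ?_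
        unfold SamplePath.likeTime
        rw [ω.likes_set_of_ne]
        intro h
        simp only [Prod.mk.injEq, Sum.inl.injEq] at h
        exact hi (h.2.1 ▸ hk)
  have hF : ∀ Y : I → Fin (T + 1), F Y =
      ∑ Z : I → Fin (T + 1), F Z * ∏ i, if Y i = Z i then (1 : ℝ) else 0 := by
    intro Y
    rw [Finset.sum_eq_single Y]
    · simp
    · intro Z _ hZ
      obtain ⟨i, hi⟩ := Function.ne_iff.1 hZ
      rw [Finset.prod_eq_zero (Finset.mem_univ i) (if_neg (Ne.symm hi)), mul_zero]
    · simp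
  conv_lhs => enter [2, ω]; rw [hF]
  rw [M.expect_sum]
  refine Finset.sum_congr rfl fun Z _ => ?_
  rw [M.expect_const_mul, hprod, mul_comm]

section Run

variable (M : Market I J) (π : Policy I J) (ω : SamplePath I J T)

theorem Market.mem_potentials_run_succ {t : ℕ} {ℓ m : User I J} :
    m ∈ M.potentials (π.run ω (t + 1)) ℓ ↔ m ∈ M.potentials (π.run ω t) ℓ ∧
      m ∉ π.display ω t ℓ ∧ ¬ (ℓ ∈ π.display ω t m ∧ ω.likes t m ℓ = false) := by
  simp only [Policy.run, Market.potentials, Policy.display, Finset.mem_sdiff, Finset.mem_union,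
    Finset.mem_filter, Finset.mem_univ, true_and, not_or, not_and, Bool.not_eq_true]
  grind

theorem Market.mem_backlog_run_succ {t : ℕ} {ℓ m : User I J} :
    m ∈ M.backlog (π.run ω (t + 1)) ℓ ↔ (m ∈ M.backlog (π.run ω t) ℓ ∨
      m ∈ M.potentials (π.run ω t) ℓ ∧ ℓ ∈ π.display ω t m ∧ ω.likes t m ℓ = true) ∧
      m ∉ π.display ω t ℓ := by
  simp only [Policy.run, Market.backlog, Policy.display, Finset.mem_sdiff, Finset.mem_union,
    Finset.mem_filter]
  grind

theorem Market.potentials_run_anti {s t : ℕ} (h : s ≤ t) (ℓ : User I J) :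
    M.potentials (π.run ω t) ℓ ⊆ M.potentials (π.run ω s) ℓ := by
  induction t, h using Nat.le_induction with
  | base => exact subset_rfl
  | succ t _ ih => exact fun m hm => ih ((M.mem_potentials_run_succ π ω).1 hm).1

theorem Market.potentials_run_subset (t : ℕ) (ℓ : User I J) :
    M.potentials (π.run ω t) ℓ ⊆ M.pot ℓ :=
  M.potentials_run_anti π ω (Nat.zero_le t) ℓ

theorem Market.notMem_potentials_of_display {s t : ℕ} (h : s < t) {ℓ m : User I J}
    (hm : m ∈ π.display ω s ℓ) : m ∉ M.potentials (π.run ω t) ℓ := fun hmt =>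
  ((M.mem_potentials_run_succ π ω).1 (M.potentials_run_anti π ω h ℓ hmt)).2.1 hm

theorem Market.exists_display_of_mem_backlog {t : ℕ} {ℓ m : User I J}
    (hm : m ∈ M.backlog (π.run ω t) ℓ) :
    ∃ s < t, ℓ ∈ π.display ω s m ∧ ω.likes s m ℓ = true ∧ m ∈ M.potentials (π.run ω s) ℓ := by
  induction t with
  | zero => simp [Policy.run, Market.backlog] at hm
  | succ t ih =>
    rcases ((M.mem_backlog_run_succ π ω).1 hm).1 with h | h
    · obtain ⟨s, hs, h⟩ := ih h
      exact ⟨s, by omega, h⟩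
    · exact ⟨t, by omega, h.2.1, h.2.2, h.1⟩

theorem Market.mem_backlog_of_display {s t : ℕ} (hst : s < t) {ℓ m : User I J}
    (h1 : ℓ ∈ π.display ω s m) (h2 : ω.likes s m ℓ = true)
    (h3 : m ∈ M.potentials (π.run ω s) ℓ) (h4 : ∀ u < t, m ∉ π.display ω u ℓ) :
    m ∈ M.backlog (π.run ω t) ℓ := by
  induction t, Nat.succ_le_of_lt hst using Nat.le_induction with
  | base => exact (M.mem_backlog_run_succ π ω).2 ⟨Or.inr ⟨h3, h1, h2⟩, h4 _ (by omega)⟩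
  | succ t ht ih =>
    exact (M.mem_backlog_run_succ π ω).2
      ⟨Or.inl (ih (by omega) fun u hu => h4 u (by omega)), h4 _ (by omega)⟩

theorem Market.exists_eq_inl {j : J} {m : User I J} (hm : m ∈ M.pot (Sum.inr j)) :
    ∃ i, m = Sum.inl i := by
  have := M.pot_bipartite _ _ hm
  cases m with
  | inl i => exact ⟨i, rfl⟩
  | inr k => simp at this

theorem Market.exists_eq_inr {i : I} {m : User I J} (hm : m ∈ M.pot (Sum.inl i)) :
    ∃ j, m = Sum.inr j := by
  have := M.pot_bipartite _ _ hm
  cases m with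
  | inr j => exact ⟨j, rfl⟩
  | inl k => simp at this

end Run

/-! ### Structure and value of admissible policies. -/

section Admissible

variable {M : Market I J} {π : Policy I J} (hπ : M.Admissible T π) (ω : SamplePath I J T)

include hπ

theorem Market.Admissible.display_subset_backlog {t : ℕ} (ht : t < T) (j : J) :
    π.display ω t (Sum.inr j) ⊆ M.backlog (π.run ω t) (Sum.inr j) := by
  intro m hm
  rcases Finset.mem_union.1 (hπ.2.1 ω t ht j hm) with h | h
  · exact h
  · obtain ⟨h1, h2⟩ := Finset.mem_filter.1 h
    obtain ⟨i, rfl⟩ := M.exists_eq_inl (M.potentials_run_subset π ω _ _ h1)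
    exact absurd ⟨hm, h2⟩ (hπ.2.2 ω t ht i j)

/-- For `j` to enter the backlog of `i`, `j` must have been shown `i`, hence from its own backlog.
Then `i` had seen `j` earlier, and `j` was no longer a potential of `i`. -/
theorem Market.Admissible.backlog_left_eq_empty {t : ℕ} (ht : t ≤ T) (i : I) :
    M.backlog (π.run ω t) (Sum.inl i) = ∅ := by
  refine Finset.eq_empty_of_forall_notMem fun m hm => ?_
  obtain ⟨s, hs, h1, -, h2⟩ := M.exists_display_of_mem_backlog π ω hm
  obtain ⟨j, rfl⟩ := M.exists_eq_inr (M.potentials_run_subset π ω _ _ h2)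
  obtain ⟨u, hu, h3, -, -⟩ := M.exists_display_of_mem_backlog π ω
    (hπ.display_subset_backlog ω (hs.trans_le ht) j h1)
  exact M.notMem_potentials_of_display π ω hu h3 h2

theorem Market.Admissible.display_unique {s t : ℕ} (hs : s < T) (ht : t < T) {ℓ m : User I J}
    (h1 : m ∈ π.display ω s ℓ) (h2 : m ∈ π.display ω t ℓ) : s = t := by
  rcases lt_trichotomy s t with h | h | h
  · exact absurd ((hπ.1 ω t ht ℓ).1 h2) (M.notMem_potentials_of_display π ω h h1)
  · exact h
  · exact absurd ((hπ.1 ω s hs ℓ).1 h1) (M.notMem_potentials_of_display π ω h h2)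

theorem Market.Admissible.mu_eq {t : ℕ} (ht : t < T) (i : I) (j : J) :
    M.mu π ω t (Sum.inl i) (Sum.inr j) = if Sum.inl i ∈ π.display ω t (Sum.inr j) ∧
      ω.likes t (Sum.inr j) (Sum.inl i) = true then 1 else 0 := by
  unfold Market.mu Policy.seesAndLikes
  have h1 := hπ.backlog_left_eq_empty ω ht.le i
  have h2 := fun h => hπ.display_subset_backlog ω ht j (x := Sum.inl i) h
  have h3 := hπ.2.2 ω t ht i j
  simp only [h1, Bool.and_eq_true, decide_eq_true_eq, Finset.notMem_empty, false_and, false_or]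
  congr 1
  apply propext
  tauto

/-- Every match is completed by a decision of some `j`, which is independent of the display it
responds to and can be replaced by its probability. -/
theorem Market.Admissible.expectedMatches_eq :
    M.expectedMatches T π = ∑ j : J, M.expect fun ω : SamplePath I J T => ∑ t : Fin T, ∑ i : I,
      if Sum.inl i ∈ π.display ω t (Sum.inr j) then M.phi (Sum.inr j) (Sum.inl i) else 0 := by
  have h1 : M.expectedMatches T π = M.expect fun ω : SamplePath I J T => ∑ j : J, ∑ t : Fin T,
      ∑ i : I, (if Sum.inl i ∈ π.display ω t (Sum.inr j) then (1 : ℝ) else 0) *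
        if ω t (Sum.inr j) (Sum.inl i) = true then 1 else 0 := by
    unfold Market.expectedMatches Market.expect
    refine Finset.sum_congr rfl fun ω _ => ?_
    congr 1
    simp only
    rw [Finset.sum_comm, Market.matches]
    push_cast
    refine Finset.sum_congr rfl fun t _ => ?_
    rw [Finset.sum_comm]
    refine Finset.sum_congr rfl fun j _ => Finset.sum_congr rfl fun i _ => ?_
    rw [hπ.mu_eq ω t.2, SamplePath.likes_of_fin]
    split_ifs <;> simp_all
  rw [h1, M.expect_sum]
  refine Finset.sum_congr rfl fun j _ => ?_
  rw [M.expect_sum, M.expect_sum]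
  refine Finset.sum_congr rfl fun t _ => ?_
  rw [M.expect_sum, M.expect_sum]
  refine Finset.sum_congr rfl fun i _ => ?_
  rw [M.expect_mul_decision t (Sum.inr j) (Sum.inl i)
    (fun ω => if Sum.inl i ∈ π.display ω t (Sum.inr j) then (1 : ℝ) else 0)
    (fun ω b => by simp only [π.display_set ω t _ _ b le_rfl])
    (fun b => if b = true then 1 else 0), ← M.expect_const_mul]
  congr 1
  funext ω
  simp

end Admissible

end Market

/-! ### Display times of a policy and the marginals of like times. -/

section DisplayTime

variable {I J : Type*} [Fintype I] [Fintype J] [DecidableEq I] [DecidableEq J] {T : ℕ}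

open Classical in
/-- The first period in which `j` is displayed to `i`, or `T` if there is none. -/
noncomputable def Policy.displayTime (π : Policy I J) (ω : SamplePath I J T) (i : I) (j : J) :
    Fin (T + 1) :=
  if h : ∃ s, s < T ∧ Sum.inr j ∈ π.display ω s (Sum.inl i) then
    ⟨Nat.find h, Nat.lt_succ_of_lt (Nat.find_spec h).1⟩
  else Fin.last T

theorem Policy.displayTime_eq_iff (π : Policy I J) (ω : SamplePath I J T) (i : I) (j : J)
    {s : ℕ} (hs : s < T) :
    (π.displayTime ω i j : ℕ) = s ↔ Sum.inr j ∈ π.display ω s (Sum.inl i) ∧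
      ∀ u < s, Sum.inr j ∉ π.display ω u (Sum.inl i) := by
  classical
  unfold Policy.displayTime
  split_ifs with h
  · simp only [Nat.find_eq_iff]
    constructor
    · exact fun h' => ⟨h'.1.2, fun u hu hm => h'.2 u hu ⟨hu.trans hs, hm⟩⟩
    · exact fun h' => ⟨⟨hs, h'.1⟩, fun u hu hm => h'.2 u hu hm.2⟩
  · simp only [Fin.val_last]
    constructor
    · omega
    · exact fun h' => absurd ⟨s, hs, h'.1⟩ h

theorem Policy.mem_display_of_displayTime (π : Policy I J) (ω : SamplePath I J T) (i : I) (j : J)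
    {s : ℕ} (hs : s < T) (h : (π.displayTime ω i j : ℕ) = s) :
    Sum.inr j ∈ π.display ω s (Sum.inl i) :=
  ((π.displayTime_eq_iff ω i j hs).1 h).1

theorem Market.Admissible.displayTime_eq {M : Market I J} {π : Policy I J}
    (hπ : M.Admissible T π) (ω : SamplePath I J T) {i : I} {j : J} {s : ℕ} (hs : s < T)
    (h : Sum.inr j ∈ π.display ω s (Sum.inl i)) : (π.displayTime ω i j : ℕ) = s :=
  (π.displayTime_eq_iff ω i j hs).2
    ⟨h, fun _ hu h' => hu.ne (hπ.display_unique ω (hu.trans hs) hs h' h)⟩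

/-- The event that the display time is `t` depends on decisions before `t` only, whereas the like is
decided in period `t`. -/
theorem Market.expect_likeTime_displayTime (M : Market I J) (π : Policy I J) (i : I) (j : J)
    (a : Fin (T + 1)) :
    (M.expect fun ω : SamplePath I J T =>
      if ω.likeTime (π.displayTime ω i j) (Sum.inl i) (Sum.inr j) = a then (1 : ℝ) else 0) =
    M.expect fun ω : SamplePath I J T =>
      likeTimeLaw (M.phi (Sum.inl i) (Sum.inr j)) (π.displayTime ω i j) a := by
  have hsplit : ∀ (ω : SamplePath I J T) (h : Fin (T + 1) → ℝ), h (π.displayTime ω i j) =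
      ∑ b, (if π.displayTime ω i j = b then 1 else 0) * h b := by
    intro ω h
    simp
  have h1 : ∀ ω : SamplePath I J T,
      (if ω.likeTime (π.displayTime ω i j) (Sum.inl i) (Sum.inr j) = a then (1 : ℝ) else 0) =
      ∑ b, (if π.displayTime ω i j = b then 1 else 0) *
        if ω.likeTime b (Sum.inl i) (Sum.inr j) = a then 1 else 0 := fun ω =>
    hsplit ω fun b => if ω.likeTime b (Sum.inl i) (Sum.inr j) = a then 1 else 0
  have h2 : ∀ ω : SamplePath I J T,
      likeTimeLaw (M.phi (Sum.inl i) (Sum.inr j)) (π.displayTime ω i j) a =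
      ∑ b, (if π.displayTime ω i j = b then 1 else 0) *
        likeTimeLaw (M.phi (Sum.inl i) (Sum.inr j)) b a := fun ω =>
    hsplit ω fun b => likeTimeLaw (M.phi (Sum.inl i) (Sum.inr j)) b a
  simp only [h1, h2]
  rw [M.expect_sum, M.expect_sum]
  refine Finset.sum_congr rfl fun b _ => ?_
  rw [M.expect_mul_likeTime, ← M.expect_const_mul]
  · simp only [mul_comm]
  · rintro t rfl ω x
    have : ∀ ω : SamplePath I J T, π.displayTime ω i j = t.castSucc ↔
        (π.displayTime ω i j : ℕ) = t := fun ω => by simp [Fin.ext_iff]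
    simp only [this]
    congr 1
    rw [π.displayTime_eq_iff _ i j t.2, π.displayTime_eq_iff _ i j t.2]
    rw [π.display_set ω t _ _ x le_rfl]
    apply propext
    refine and_congr Iff.rfl (forall₂_congr fun u hu => ?_)
    rw [π.display_set ω t _ _ x hu.le]

end DisplayTime

/-! ### The queue bound for admissible policies. -/

section Levels

variable {I J : Type*} [Fintype I] [Fintype J] [DecidableEq I] [DecidableEq J] {T : ℕ}

/-- The number of displays of members of `U` to `j` before period `t`. -/
def Policy.shownCount (π : Policy I J) (ω : SamplePath I J T) (U : Finset I) (j : J) (t : ℕ) : ℕ :=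
  ∑ s ∈ Finset.range t, (U.filter fun i => Sum.inl i ∈ π.display ω s (Sum.inr j)).card

theorem Market.Admissible.card_shown_le {M : Market I J} {π : Policy I J}
    (hπ : M.Admissible T π) (ω : SamplePath I J T) (U : Finset I) (j : J) {t : ℕ} (ht : t < T) :
    (U.filter fun i => Sum.inl i ∈ π.display ω t (Sum.inr j)).card ≤ M.K (Sum.inr j) := by
  refine le_trans ?_ (hπ.1 ω t ht (Sum.inr j)).2
  exact Finset.card_le_card_of_injOn Sum.inl (fun i hi => by simpa using (Finset.mem_filter.1 hi).2)
    Sum.inl_injective.injOn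

/-- No admissible policy displays more members of `U` to `j` than a queue serves. -/
theorem Market.Admissible.shownCount_le {M : Market I J} {π : Policy I J}
    (hπ : M.Admissible T π) (ω : SamplePath I J T) (U : Finset I) (j : J) {t : ℕ} (ht : t ≤ T) :
    π.shownCount ω U j t ≤ served U (M.K (Sum.inr j))
      (fun i => ω.likeTime (π.displayTime ω i j) (Sum.inl i) (Sum.inr j)) t := by
  induction t with
  | zero => simp [Policy.shownCount, served]
  | succ t ih =>
    refine le_min ?_ ?_
    · rw [Policy.shownCount, Finset.sum_range_succ]
      exact add_le_add (ih (by omega)) (hπ.card_shown_le ω U j (by omega))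
    · rw [Policy.shownCount, ← Finset.card_biUnion]
      -- Whoever is shown to `j` in a period `s ≤ t` came from the backlog, so liked `j` strictly
      -- before `s`.
      · refine Finset.card_le_card fun i hi => ?_
        simp only [Finset.mem_biUnion, Finset.mem_range, Finset.mem_filter] at hi ⊢
        obtain ⟨s, hs, hiU, hshown⟩ := hi
        obtain ⟨u, hu, h1, h2, -⟩ := M.exists_display_of_mem_backlog π ω
          (hπ.display_subset_backlog ω (by omega : s < T) j hshown)
        refine ⟨hiU, ?_⟩
        have h3 := hπ.displayTime_eq ω (by omega : u < T) h1
        rw [SamplePath.likeTime, h3, if_pos h2, h3]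
        omega
      · intro s hs u hu hne
        simp only [Finset.coe_range, Set.mem_Iio] at hs hu
        refine Finset.disjoint_left.2 fun i h1 h2 => hne ?_
        exact hπ.display_unique ω (by omega) (by omega) (Finset.mem_filter.1 h1).2
          (Finset.mem_filter.1 h2).2

end Levels

/-! ### Fixed schedules with greedy use of the backlog. -/

section InitiatePolicy

variable {I J : Type*} [Fintype I] [Fintype J] [DecidableEq I] [DecidableEq J] {T : ℕ}

/-- The users in the backlog of `j` with the largest like probabilities. -/
noncomputable def Market.topBacklog (M : Market I J) (h : History I J) (j : J) : Finset I :=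
  Classical.choose (exists_top_subset (fun i => M.phi (Sum.inr j) (Sum.inl i)) (M.K (Sum.inr j))
    (Finset.univ.filter fun i => Sum.inl i ∈ M.backlog h (Sum.inr j)))

theorem Market.mem_backlog_of_mem_topBacklog (M : Market I J) {h : History I J} {j : J} {i : I}
    (hi : i ∈ M.topBacklog h j) : Sum.inl i ∈ M.backlog h (Sum.inr j) := by
  have := (Classical.choose_spec (exists_top_subset (fun i => M.phi (Sum.inr j) (Sum.inl i))
    (M.K (Sum.inr j)) (Finset.univ.filter fun i => Sum.inl i ∈ M.backlog h (Sum.inr j)))).1 hi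
  simpa using this

theorem Market.card_topBacklog_le (M : Market I J) (h : History I J) (j : J) :
    (M.topBacklog h j).card ≤ M.K (Sum.inr j) :=
  (Classical.choose_spec (exists_top_subset (fun i => M.phi (Sum.inr j) (Sum.inl i))
    (M.K (Sum.inr j)) (Finset.univ.filter fun i => Sum.inl i ∈ M.backlog h (Sum.inr j)))).2.1

theorem Market.min_le_card_topBacklog (M : Market I J) (h : History I J) (j : J) (θ : ℝ) :
    min (M.K (Sum.inr j)) ((Finset.univ.filter fun i => Sum.inl i ∈ M.backlog h (Sum.inr j)).filter
        fun i => θ ≤ M.phi (Sum.inr j) (Sum.inl i)).card ≤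
      ((M.topBacklog h j).filter fun i => θ ≤ M.phi (Sum.inr j) (Sum.inl i)).card :=
  (Classical.choose_spec (exists_top_subset (fun i => M.phi (Sum.inr j) (Sum.inl i))
    (M.K (Sum.inr j)) (Finset.univ.filter fun i => Sum.inl i ∈ M.backlog h (Sum.inr j)))).2.2 θ

/-- The policy that displays `j` to `i` in period `a i j`, and to each `j` the best profiles in
the backlog. -/
noncomputable def Market.initiatePolicy (M : Market I J) (a : I → J → Fin (T + 1)) : Policy I J :=
  fun h ℓ => match ℓ with
  -- The history enters only through its length, the current period, so initiating displays ignore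
  -- past decisions. The time `T` means never.
  | Sum.inl i => (Finset.univ.filter fun j => (a i j : ℕ) = h.length).image Sum.inr
  | Sum.inr j => (M.topBacklog h j).image Sum.inl

/-- A schedule of the initiating displays that respects the potentials and the capacities. -/
def Market.IsSchedule (M : Market I J) (a : I → J → Fin (T + 1)) : Prop :=
  ∀ i, (∀ j, (a i j : ℕ) < T → Sum.inr j ∈ M.pot (Sum.inl i)) ∧
    ∀ t < T, (Finset.univ.filter fun j => (a i j : ℕ) = t).card ≤ M.K (Sum.inl i)

/-- Every user `i` may follow the display times of an admissible policy on a sample path of its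
own. -/
theorem Market.Admissible.isSchedule_displayTime {M : Market I J} {π : Policy I J}
    (hπ : M.Admissible T π) (ω : I → SamplePath I J T) :
    M.IsSchedule fun i j => π.displayTime (ω i) i j := by
  intro i
  refine ⟨fun j hj => ?_, fun t ht => ?_⟩
  · exact M.potentials_run_subset π (ω i) _ _ ((hπ.1 (ω i) _ hj _).1
      (π.mem_display_of_displayTime (ω i) i j hj rfl))
  -- All times of `i` are read off the single path `ω i`, where `π` displays these profiles
  -- together.
  · refine le_trans ?_ (hπ.1 (ω i) t ht (Sum.inl i)).2
    refine Finset.card_le_card_of_injOn Sum.inr (fun j hj => ?_) Sum.inr_injective.injOn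
    exact π.mem_display_of_displayTime (ω i) i j ht (Finset.mem_filter.1 hj).2

variable (M : Market I J) (a : I → J → Fin (T + 1)) (ω : SamplePath I J T)

theorem Market.mem_display_initiatePolicy_inl {t : ℕ} {i : I} {m : User I J} :
    m ∈ (M.initiatePolicy a).display ω t (Sum.inl i) ↔
      ∃ j, (a i j : ℕ) = t ∧ Sum.inr j = m := by
  simp [Policy.display, Market.initiatePolicy, Policy.length_run]

theorem Market.mem_display_initiatePolicy_inr {t : ℕ} {j : J} {m : User I J} :
    m ∈ (M.initiatePolicy a).display ω t (Sum.inr j) ↔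
      ∃ i ∈ M.topBacklog ((M.initiatePolicy a).run ω t) j, Sum.inl i = m := by
  simp [Policy.display, Market.initiatePolicy]

theorem Market.inr_mem_display_initiatePolicy {t : ℕ} {i : I} {j : J} :
    Sum.inr j ∈ (M.initiatePolicy a).display ω t (Sum.inl i) ↔ (a i j : ℕ) = t := by
  simp [M.mem_display_initiatePolicy_inl a ω]

theorem Market.inl_mem_display_initiatePolicy {t : ℕ} {i : I} {j : J} :
    Sum.inl i ∈ (M.initiatePolicy a).display ω t (Sum.inr j) ↔
      i ∈ M.topBacklog ((M.initiatePolicy a).run ω t) j := by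
  simp [M.mem_display_initiatePolicy_inr a ω]

theorem Market.lt_of_mem_display_initiatePolicy {t : ℕ} {i : I} {j : J}
    (h : Sum.inl i ∈ (M.initiatePolicy a).display ω t (Sum.inr j)) : (a i j : ℕ) < t := by
  obtain ⟨s, hs, h1, -, -⟩ := M.exists_display_of_mem_backlog _ ω
    (M.mem_backlog_of_mem_topBacklog ((M.inl_mem_display_initiatePolicy a ω).1 h))
  rwa [(M.inr_mem_display_initiatePolicy a ω).1 h1]

theorem Market.inr_mem_potentials_initiatePolicy {t : ℕ} {i : I} {j : J}
    (hpot : Sum.inr j ∈ M.pot (Sum.inl i)) (ht : t ≤ a i j) :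
    Sum.inr j ∈ M.potentials ((M.initiatePolicy a).run ω t) (Sum.inl i) := by
  induction t with
  | zero => exact hpot
  | succ t ih =>
    refine (M.mem_potentials_run_succ _ ω).2 ⟨ih (by omega), ?_, fun h => ?_⟩
    · rw [M.inr_mem_display_initiatePolicy a ω]
      omega
    · have := M.lt_of_mem_display_initiatePolicy a ω h.1
      omega

theorem Market.inl_mem_potentials_initiatePolicy {t : ℕ} {i : I} {j : J}
    (hpot : Sum.inl i ∈ M.pot (Sum.inr j)) (ht : t ≤ a i j) :
    Sum.inl i ∈ M.potentials ((M.initiatePolicy a).run ω t) (Sum.inr j) := by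
  induction t with
  | zero => exact hpot
  | succ t ih =>
    refine (M.mem_potentials_run_succ _ ω).2 ⟨ih (by omega), fun h => ?_, fun h => ?_⟩
    · have := M.lt_of_mem_display_initiatePolicy a ω h
      omega
    · have := (M.inr_mem_display_initiatePolicy a ω).1 h.1
      omega

/-- A scheduled `j` is displayed to `i` in one period only, so a user who liked `j` cannot dislike
`j` later. -/
theorem Market.backlog_subset_potentials_initiatePolicy (t : ℕ) (j : J) :
    M.backlog ((M.initiatePolicy a).run ω t) (Sum.inr j) ⊆
      M.potentials ((M.initiatePolicy a).run ω t) (Sum.inr j) := by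
  induction t with
  | zero => simp [Policy.run, Market.backlog]
  | succ t ih =>
    intro m hm
    obtain ⟨h1, h2⟩ := (M.mem_backlog_run_succ _ ω).1 hm
    refine (M.mem_potentials_run_succ _ ω).2 ⟨h1.elim (fun h => ih h) fun h => h.1, h2, fun h => ?_⟩
    rcases h1 with h1 | h1
    · obtain ⟨s, hs, h3, -, h4⟩ := M.exists_display_of_mem_backlog _ ω h1
      obtain ⟨i, rfl⟩ := M.exists_eq_inl (M.potentials_run_subset _ ω _ _ h4)
      have h5 := (M.inr_mem_display_initiatePolicy a ω).1 h3
      have h6 := (M.inr_mem_display_initiatePolicy a ω).1 h.1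
      omega
    · simp [h1.2.2] at h

variable {M a}

theorem Market.IsSchedule.admissible (ha : M.IsSchedule a) :
    M.Admissible T (M.initiatePolicy a) := by
  have hback : ∀ (ω : SamplePath I J T) (t : ℕ) (j : J),
      (M.initiatePolicy a).display ω t (Sum.inr j) ⊆
        M.backlog ((M.initiatePolicy a).run ω t) (Sum.inr j) := by
    intro ω t j m hm
    obtain ⟨i, hi, rfl⟩ := (M.mem_display_initiatePolicy_inr a ω).1 hm
    exact M.mem_backlog_of_mem_topBacklog hi
  refine ⟨fun ω t ht ℓ => ?_, fun ω t ht j => (hback ω t j).trans Finset.subset_union_left,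
    fun ω t ht i j h => ?_⟩
  · cases ℓ with
    | inl i =>
      refine ⟨fun m hm => ?_, ?_⟩
      · obtain ⟨j, hj, rfl⟩ := (M.mem_display_initiatePolicy_inl a ω).1 hm
        exact M.inr_mem_potentials_initiatePolicy a ω ((ha i).1 j (by omega)) hj.ge
      · refine Finset.card_image_le.trans ?_
        rw [Policy.length_run]
        exact (ha i).2 t ht
    | inr j =>
      exact ⟨(hback ω t j).trans (M.backlog_subset_potentials_initiatePolicy a ω t j),
        Finset.card_image_le.trans (M.card_topBacklog_le _ _)⟩
  · have h1 := M.lt_of_mem_display_initiatePolicy a ω h.1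
    have h2 := (M.inr_mem_display_initiatePolicy a ω).1 h.2
    omega

theorem Market.IsSchedule.semiAdaptive (ha : M.IsSchedule a) :
    M.SemiAdaptive T (M.initiatePolicy a) := by
  intro ω ω' t ht ℓ
  cases ℓ with
  | inl i =>
    rw [ha.admissible.backlog_left_eq_empty ω ht.le, ha.admissible.backlog_left_eq_empty ω' ht.le]
    simp only [Policy.display, Market.initiatePolicy, Policy.length_run]
  | inr j =>
    rw [Finset.sdiff_eq_empty_iff_subset.2 (ha.admissible.display_subset_backlog ω ht j),
      Finset.sdiff_eq_empty_iff_subset.2 (ha.admissible.display_subset_backlog ω' ht j)]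

variable (M a)

/-- The policy displays as many profiles of every level to `j` as a queue serves. -/
theorem Market.served_le_shownCount (j : J) (θ : ℝ) {t : ℕ} (ht : t ≤ T) :
    served (Finset.univ.filter fun i =>
        Sum.inl i ∈ M.pot (Sum.inr j) ∧ θ ≤ M.phi (Sum.inr j) (Sum.inl i)) (M.K (Sum.inr j))
      (fun i => ω.likeTime (a i j) (Sum.inl i) (Sum.inr j)) t ≤
    (M.initiatePolicy a).shownCount ω (Finset.univ.filter fun i =>
        Sum.inl i ∈ M.pot (Sum.inr j) ∧ θ ≤ M.phi (Sum.inr j) (Sum.inl i)) j t := by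
  set U := Finset.univ.filter fun i =>
    Sum.inl i ∈ M.pot (Sum.inr j) ∧ θ ≤ M.phi (Sum.inr j) (Sum.inl i) with hU
  set π := M.initiatePolicy a with hπ
  induction t with
  | zero => simp [served]
  | succ t ih =>
    have ih := ih (by omega)
    have htop := M.min_le_card_topBacklog (π.run ω t) j θ
    have hshown : ((M.topBacklog (π.run ω t) j).filter fun i =>
        θ ≤ M.phi (Sum.inr j) (Sum.inl i)).card ≤
        (U.filter fun i => Sum.inl i ∈ π.display ω t (Sum.inr j)).card := by
      refine Finset.card_le_card fun i hi => ?_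
      obtain ⟨h1, h2⟩ := Finset.mem_filter.1 hi
      have h3 := M.potentials_run_subset π ω _ _
        (M.backlog_subset_potentials_initiatePolicy a ω t j (M.mem_backlog_of_mem_topBacklog h1))
      simp only [hU, Finset.mem_filter, Finset.mem_univ, true_and]
      exact ⟨⟨h3, h2⟩, (M.inl_mem_display_initiatePolicy a ω).2 h1⟩
    -- Everyone in `U` who has liked `j` was either shown already or is still in the backlog.
    have harr : arrivals U (fun i => ω.likeTime (a i j) (Sum.inl i) (Sum.inr j)) t ≤
        ((Finset.univ.filter fun i => Sum.inl i ∈ M.backlog (π.run ω t) (Sum.inr j)).filter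
          fun i => θ ≤ M.phi (Sum.inr j) (Sum.inl i)).card + π.shownCount ω U j t := by
      refine le_trans (Finset.card_le_card ?_) ((Finset.card_union_le _ _).trans
        (Nat.add_le_add_left Finset.card_biUnion_le _))
      intro i hi
      obtain ⟨hiU, hlt⟩ := Finset.mem_filter.1 hi
      obtain ⟨hpot, hθ⟩ := (Finset.mem_filter.1 hiU).2
      by_cases hs : ∃ s < t, Sum.inl i ∈ π.display ω s (Sum.inr j)
      · obtain ⟨s, hs, hm⟩ := hs
        exact Finset.mem_union_right _ (Finset.mem_biUnion.2
          ⟨s, Finset.mem_range.2 hs, Finset.mem_filter.2 ⟨hiU, hm⟩⟩)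
      · push Not at hs
        refine Finset.mem_union_left _ ?_
        simp only [Finset.mem_filter, Finset.mem_univ, true_and]
        refine ⟨?_, hθ⟩
        simp only [SamplePath.likeTime] at hlt
        split_ifs at hlt with hl
        · exact M.mem_backlog_of_display π ω hlt ((M.inr_mem_display_initiatePolicy a ω).2 rfl) hl
            (M.inl_mem_potentials_initiatePolicy a ω hpot le_rfl) hs
        · simp only [Fin.val_last] at hlt
          omega
    have hsucc : π.shownCount ω U j (t + 1) = π.shownCount ω U j t +
        (U.filter fun i => Sum.inl i ∈ π.display ω t (Sum.inr j)).card :=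
      Finset.sum_range_succ _ _
    rw [hsucc]
    simp only [served]
    omega

/-- A bound on the value collected by `j` that depends only on the times at which `j` is liked, is
valid for all admissible policies, and is attained by the policies `Market.initiatePolicy`. -/
theorem Market.exists_value_function (T : ℕ) (j : J) : ∃ f : (I → Fin (T + 1)) → ℝ,
    HasMarginalBound (Fin.last T) f ∧ (∀ Y, 0 ≤ f Y) ∧
    (∀ π, M.Admissible T π → ∀ ω : SamplePath I J T,
      (∑ t : Fin T, ∑ i : I, if Sum.inl i ∈ π.display ω t (Sum.inr j) then
        M.phi (Sum.inr j) (Sum.inl i) else 0) ≤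
      f fun i => ω.likeTime (π.displayTime ω i j) (Sum.inl i) (Sum.inr j)) ∧
    ∀ a : I → J → Fin (T + 1), M.IsSchedule a → ∀ ω : SamplePath I J T,
      (f fun i => ω.likeTime (a i j) (Sum.inl i) (Sum.inr j)) ≤
      ∑ t : Fin T, ∑ i : I, if Sum.inl i ∈ (M.initiatePolicy a).display ω t (Sum.inr j) then
        M.phi (Sum.inr j) (Sum.inl i) else 0 := by
  obtain ⟨c, hc, hv⟩ := exists_layer_weights
    (Finset.univ.image fun i : I => M.phi (Sum.inr j) (Sum.inl i)) (by
      intro v hv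
      obtain ⟨i, -, rfl⟩ := Finset.mem_image.1 hv
      exact M.phi_nonneg _ _)
  set W := Finset.univ.image fun i : I => M.phi (Sum.inr j) (Sum.inl i) with hW
  -- A schedule only ensures that `j` is a potential of `i`. The converse is imposed here, since
  -- otherwise `i` cannot enter the backlog of `j`.
  set U : ℝ → Finset I := fun θ => Finset.univ.filter fun i =>
    Sum.inl i ∈ M.pot (Sum.inr j) ∧ θ ≤ M.phi (Sum.inr j) (Sum.inl i) with hU
  have hlayer : ∀ π, M.Admissible T π → ∀ ω : SamplePath I J T,
      (∑ t : Fin T, ∑ i : I, if Sum.inl i ∈ π.display ω t (Sum.inr j) then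
        M.phi (Sum.inr j) (Sum.inl i) else 0) =
      ∑ θ ∈ W, c θ * (π.shownCount ω (U θ) j T : ℝ) := by
    intro π hπ ω
    have hterm : ∀ (t : Fin T) (i : I), (if Sum.inl i ∈ π.display ω t (Sum.inr j) then
        M.phi (Sum.inr j) (Sum.inl i) else 0) = ∑ θ ∈ W, c θ *
          if i ∈ U θ ∧ Sum.inl i ∈ π.display ω t (Sum.inr j) then 1 else 0 := by
      intro t i
      split_ifs with h
      · have hpot := M.potentials_run_subset π ω _ _ ((hπ.1 ω t t.2 _).1 h)
        conv_lhs => rw [hv _ (Finset.mem_image_of_mem _ (Finset.mem_univ i))]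
        refine Finset.sum_congr rfl fun θ _ => ?_
        simp [hU, hpot, h]
      · simp [h]
    simp only [hterm]
    rw [Finset.sum_congr rfl fun t _ => Finset.sum_comm, Finset.sum_comm]
    refine Finset.sum_congr rfl fun θ _ => ?_
    simp only [← Finset.mul_sum]
    congr 1
    rw [Policy.shownCount, ← Fin.sum_univ_eq_sum_range
      fun s => ((U θ).filter fun i => Sum.inl i ∈ π.display ω s (Sum.inr j)).card]
    push_cast
    refine Finset.sum_congr rfl fun t _ => ?_
    rw [Finset.sum_boole]
    congr 2
    ext i
    simp
  refine ⟨fun Y => ∑ θ ∈ W, c θ * (served (U θ) (M.K (Sum.inr j)) Y T : ℝ), ?_, ?_, ?_, ?_⟩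
  · exact HasMarginalBound.sum W c (fun θ Y => (served (U θ) (M.K (Sum.inr j)) Y T : ℝ)) hc
      fun θ _ => hasMarginalBound_served (U θ) _
  · exact fun Y => Finset.sum_nonneg fun θ hθ => mul_nonneg (hc θ hθ) (Nat.cast_nonneg _)
  · intro π hπ ω
    rw [hlayer π hπ ω]
    refine Finset.sum_le_sum fun θ hθ => mul_le_mul_of_nonneg_left ?_ (hc θ hθ)
    exact_mod_cast hπ.shownCount_le ω (U θ) j le_rfl
  · intro a ha ω
    rw [hlayer _ ha.admissible ω]
    refine Finset.sum_le_sum fun θ hθ => mul_le_mul_of_nonneg_left ?_ (hc θ hθ)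
    exact_mod_cast M.served_le_shownCount a ω j θ le_rfl

/-! ### Comparison of adaptive policies with schedules. -/

/-- For every admissible policy there is a schedule whose value is at least `1 - 1/e` times the
value of the policy. -/
theorem Market.Admissible.exists_schedule {M : Market I J} {π : Policy I J}
    (hπ : M.Admissible T π) : ∃ a : I → J → Fin (T + 1), M.IsSchedule a ∧
      (1 - 1 / Real.exp 1) * M.expectedMatches T π ≤
        M.expectedMatches T (M.initiatePolicy a) := by
  choose f hf hf0 hub hlb using M.exists_value_function T
  set law : (j : J) → (I → Fin (T + 1)) → (I → Fin (T + 1)) → ℝ := fun j b Z =>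
    ∏ i, likeTimeLaw (M.phi (Sum.inl i) (Sum.inr j)) (b i) (Z i) with hlaw
  set V : (I → J → Fin (T + 1)) → ℝ := fun a =>
    ∑ j, ∑ Z : I → Fin (T + 1), law j (fun i => a i j) Z * f j Z with hV
  have hVle : ∀ a, M.IsSchedule a → V a ≤ M.expectedMatches T (M.initiatePolicy a) := by
    intro a ha
    rw [ha.admissible.expectedMatches_eq]
    refine Finset.sum_le_sum fun j _ => ?_
    rw [← M.expect_likeTime (fun i => a i j) j (f j)]
    exact M.expect_mono fun ω => hlb j a ha ω
  have he : 0 ≤ 1 - 1 / Real.exp 1 := by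
    rw [sub_nonneg, div_le_one (Real.exp_pos 1)]
    exact Real.one_le_exp zero_le_one
  have hmean : (1 - 1 / Real.exp 1) * M.expectedMatches T π ≤
      ∑ ω : I → SamplePath I J T, (∏ i, M.pathProb (ω i)) *
        V fun i j => π.displayTime (ω i) i j := by
    -- For fixed `j`, the display times read off private paths are independent over `i`, so
    -- averaging over these paths gives the product of the marginals of the like times under `π`.
    have hrhs : ∑ ω : I → SamplePath I J T, (∏ i, M.pathProb (ω i)) *
        V (fun i j => π.displayTime (ω i) i j) =
        ∑ j, ∑ Z : I → Fin (T + 1), (∏ i, ∑ ω : SamplePath I J T, M.pathProb ω *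
          if ω.likeTime (π.displayTime ω i j) (Sum.inl i) (Sum.inr j) = Z i then 1 else 0) *
            f j Z := by
      simp only [hV, Finset.mul_sum]
      rw [Finset.sum_comm]
      refine Finset.sum_congr rfl fun j _ => ?_
      rw [Finset.sum_comm]
      refine Finset.sum_congr rfl fun Z _ => ?_
      have h1 : ∀ i, ∑ ω : SamplePath I J T, M.pathProb ω *
          (if ω.likeTime (π.displayTime ω i j) (Sum.inl i) (Sum.inr j) = Z i then 1 else 0) =
          ∑ ω : SamplePath I J T, M.pathProb ω *
            likeTimeLaw (M.phi (Sum.inl i) (Sum.inr j)) (π.displayTime ω i j) (Z i) := fun i =>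
        M.expect_likeTime_displayTime π i j (Z i)
      simp only [h1]
      rw [Finset.prod_univ_sum, Fintype.piFinset_univ, Finset.sum_mul]
      refine Finset.sum_congr rfl fun ω _ => ?_
      rw [Finset.prod_mul_distrib, mul_assoc]
    rw [hrhs, hπ.expectedMatches_eq, Finset.mul_sum]
    refine Finset.sum_le_sum fun j _ => ?_
    refine le_trans ?_ ((hf j).correlation_gap (hf0 j) M.pathProb M.pathProb_nonneg
      M.sum_pathProb fun ω i => ω.likeTime (π.displayTime ω i j) (Sum.inl i) (Sum.inr j))
    exact mul_le_mul_of_nonneg_left (M.expect_mono fun ω => hub j π hπ ω) he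
  have hone : ∑ ω : I → SamplePath I J T, ∏ i, M.pathProb (ω i) = 1 :=
    sum_prod_eq_one (fun (_ : I) (ω : SamplePath I J T) => M.pathProb ω) fun _ => M.sum_pathProb
  -- Derandomization: some family of private paths reaches the average.
  obtain ⟨ω, hω⟩ : ∃ ω : I → SamplePath I J T, (1 - 1 / Real.exp 1) * M.expectedMatches T π ≤
      V fun i j => π.displayTime (ω i) i j := by
    by_contra! hcon
    have hle : ∀ ω ∈ (Finset.univ : Finset (I → SamplePath I J T)),
        (∏ i, M.pathProb (ω i)) * V (fun i j => π.displayTime (ω i) i j) ≤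
        (∏ i, M.pathProb (ω i)) * ((1 - 1 / Real.exp 1) * M.expectedMatches T π) := fun ω _ =>
      mul_le_mul_of_nonneg_left (hcon ω).le (Finset.prod_nonneg fun i _ => M.pathProb_nonneg _)
    obtain ⟨ω, hω, hpos⟩ := Finset.exists_ne_zero_of_sum_ne_zero (hone.trans_ne one_ne_zero)
    have hlt := Finset.sum_lt_sum hle ⟨ω, hω, mul_lt_mul_of_pos_left (hcon ω)
      (lt_of_le_of_ne (Finset.prod_nonneg fun i _ => M.pathProb_nonneg _) hpos.symm)⟩
    rw [← Finset.sum_mul, hone, one_mul] at hlt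
    linarith
  exact ⟨_, hπ.isSchedule_displayTime ω, hω.trans (hVle _ (hπ.isSchedule_displayTime ω))⟩

end InitiatePolicy

/-! ### Randomized policies and the conclusion. -/

section Value

variable {I J : Type*} [Fintype I] [Fintype J] [DecidableEq I] [DecidableEq J]

theorem Market.expectedMatches_nonneg (M : Market I J) (T : ℕ) (π : Policy I J) :
    0 ≤ M.expectedMatches T π :=
  Finset.sum_nonneg fun ω _ => mul_nonneg (M.pathProb_nonneg ω) (Nat.cast_nonneg _)

theorem Market.value_pure (M : Market I J) (T : ℕ) (π : Policy I J) :
    M.value T (PMF.pure π) = M.expectedMatches T π := by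
  classical
  rw [Market.value, tsum_eq_single π]
  · simp
  · intro π' h
    simp [PMF.pure_apply, h]

theorem Market.mul_value_le (M : Market I J) (T : ℕ) (ρ : PMF (Policy I J)) {c V : ℝ} (hc : 0 < c)
    (h : ∀ π ∈ ρ.support, c * M.expectedMatches T π ≤ V) : c * M.value T ρ ≤ V := by
  have hle : ∀ π, (ρ π).toReal * M.expectedMatches T π ≤ (ρ π).toReal * (V / c) := by
    intro π
    by_cases hπ : π ∈ ρ.support
    · refine mul_le_mul_of_nonneg_left ?_ ENNReal.toReal_nonneg
      rw [le_div_iff₀ hc, mul_comm]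
      exact h π hπ
    · simp [(PMF.apply_eq_zero_iff ρ π).2 hπ]
  have hsum : Summable fun π => (ρ π).toReal * (V / c) :=
    (ENNReal.summable_toReal ρ.tsum_coe_ne_top).mul_right _
  have hone : ∑' π, (ρ π).toReal = 1 := by
    rw [← ENNReal.tsum_toReal_eq ρ.apply_ne_top, ρ.tsum_coe, ENNReal.toReal_one]
  have hval : M.value T ρ ≤ V / c := by
    calc M.value T ρ ≤ ∑' π, (ρ π).toReal * (V / c) :=
          (hsum.of_nonneg_of_le (fun π => mul_nonneg ENNReal.toReal_nonneg
            (M.expectedMatches_nonneg T π)) hle).tsum_le_tsum hle hsum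
      _ = V / c := by rw [tsum_mul_right, hone, one_mul]
  rw [le_div_iff₀ hc] at hval
  linarith

end Value

theorem theorem3 {I J : Type*} [Fintype I] [Fintype J] [DecidableEq I] [DecidableEq J]
    (M : Market I J) (T : ℕ) :
    ∃ σ : PMF (Policy I J),
      (∀ π ∈ σ.support, M.Admissible T π ∧ M.SemiAdaptive T π) ∧
      ∀ ρ : PMF (Policy I J), (∀ π ∈ ρ.support, M.Admissible T π) →
        (1 - 1 / Real.exp 1) * M.value T ρ ≤ M.value T σ := by
  classical
  have hne : (Finset.univ.filter fun a : I → J → Fin (T + 1) => M.IsSchedule a).Nonempty := by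
    refine ⟨fun _ _ => Fin.last T, Finset.mem_filter.2 ⟨Finset.mem_univ _, fun i =>
      ⟨fun j hj => absurd hj (by simp), fun t ht => ?_⟩⟩⟩
    rw [Finset.filter_false_of_mem fun j _ => by simpa using ht.ne']
    simp
  -- The schedule from `exists_schedule` depends on the competitor; the best of the finitely many
  -- schedules serves against all of them.
  obtain ⟨a, ha, hmax⟩ := Finset.exists_max_image _
    (fun a => M.expectedMatches T (M.initiatePolicy a)) hne
  have ha := (Finset.mem_filter.1 ha).2
  refine ⟨PMF.pure (M.initiatePolicy a), fun π hπ => ?_, fun ρ hρ => ?_⟩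
  · rw [PMF.mem_support_pure_iff] at hπ
    exact hπ ▸ ⟨ha.admissible, ha.semiAdaptive⟩
  · rw [M.value_pure]
    have he : 0 < 1 - 1 / Real.exp 1 := by
      rw [sub_pos, div_lt_one (Real.exp_pos 1)]
      exact Real.one_lt_exp_iff.2 one_pos
    refine M.mul_value_le T ρ he fun π hπ => ?_
    obtain ⟨b, hb, hle⟩ := (hρ π hπ).exists_schedule
    exact hle.trans (hmax b (Finset.mem_filter.2 ⟨Finset.mem_univ _, hb⟩))
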